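/- Let $X$ be a real Hilbert space, let $A,B\colon X\rightrightarrows X$ be maximally monotone, let $J_A=(\mathrm{Id}+A)^{-1}$ and $R_A=2J_A-\mathrm{Id}$ be the resolvent and the reflected resolvent of $A$ (and likewise for other operators), and let $T=\mathrm{Id}-J_A+J_BR_A$ be the Douglas--Rachford operator. Put $D=\operatorname{dom}A-\operatorname{dom}B$ and $R=\operatorname{ran}A+\operatorname{ran}B$, and assume that $$\overline{\operatorname{ran}}(\mathrm{Id}-T)=\overline{D\cap R}=\overline D\cap\overline R .$$ Let $v$, $v_D$, $v_R$ be the projections of $0$ onto the closed convex sets $\overline{\operatorname{ran}}(\mathrm{Id}-T)$, $\overline D$, $\overline R$, respectively. Let $$Z=\{z\in X: 0\in -v+Az+B(z-v)\},\qquad \mathcal S=\{(z,k)\in X\times X: -k\in B(z-v),\ k\in -v+Az\},$$ and let $K=\{k\in X: 0\in(-v+A)^{-1}(k)-(B(\cdot-v))^{-1}(-k)\}$ be the set of solutions of the Attouch--Théra dual of the problem defining $Z$. Equip $X\times X$ with the Hilbert product norm $\|(a,b)\|^2=\|a\|^2+\|b\|^2$. A sequence $(y_n)_{n\in\mathbb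 N}$ in a Hilbert space is Fejér monotone with respect to a nonempty set $C$ if $\|y_{n+1}-c\|\le\|y_n-c\|$ for all $c\in C$ and $n\in\mathbb N$. A monotone operator $C$ is paramonotone if $u\in Cx$, $w\in Cy$ and $\langle x-y,u-w\rangle=0$ imply $w\in Cx$ and $u\in Cy$. Suppose that $\operatorname{Fix}(v+T)=\{f\in X: f=v+Tf\}\neq\varnothing$ and let $x\in X$. Then the following hold: 1. The sequence $(J_AT^nx+nv_R,\;J_{A^{-1}}T^nx+nv_D)_{n\in\mathbb N}$ is Fejér monotone with respect to $\{(J_Af,J_{A^{-1}}f): f\in\operatorname{Fix}(v+T)\}$. 2. The sequence $(J_AT^nx+nv_R,\;J_{A^{-1}}T^nx+nv_D)_{n\in\mathbb N}$ is bounded. 3. The sequence $(J_BR_AT^nx+nv_R,\;J_{B^{-1}}R_AT^nx-nv_D)_{n\in\mathbb N}$ is bounded. 4. The sequence $\big((0,-v)+(J_AT^nx+nv_R,\;J_{A^{-1}}T^nx+nv_D)\big)_{n\in\mathbb N}$ is Fejér monotone with respect to $\mathcal S$. 5. $(J_AT^nx)_{n\in\mathbb N}$ is bounded if and only if $v_R=0$.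 6. If $v_R\neq0$, then $\|J_AT^nx\|\to+\infty$. 7. $(J_{A^{-1}}T^nx)_{n\in\mathbb N}$ is bounded if and only if $v_D=0$. 8. If $v_D\neq0$, then $\|J_{A^{-1}}T^nx\|\to+\infty$. 9. If $A$ and $B$ are paramonotone, then the sequence $\big((0,-v)+(J_AT^nx+nv_R,\;J_{A^{-1}}T^nx+nv_D)\big)_{n\in\mathbb N}$ is Fejér monotone with respect to $Z\times K$. -/

import Mathlib

namespace DouglasRachford

/-! ### Set-valued operators on a real Hilbert space -/

section Operators

variable {X : Type*} [NormedAddCommGroup X] [InnerProductSpace ℝ X]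

/-- The domain of a set-valued operator, `{x | A x ≠ ∅}`. -/
def opDom (A : X → Set X) : Set X := {x | (A x).Nonempty}

/-- The range of a set-valued operator, `⋃ x, A x`. -/
def opRan (A : X → Set X) : Set X := ⋃ x, A x

/-- The inverse of a set-valued operator: `x ∈ A⁻¹ u` iff `u ∈ A x`. -/
def opInv (A : X → Set X) : X → Set X := fun u => {x | u ∈ A x}

/-- The pointwise Minkowski sum of two set-valued operators. -/
def opAdd (A B : X → Set X) : X → Set X :=
  fun x => {w | ∃ u ∈ A x, ∃ u' ∈ B x, w = u + u'}

/-- The set of zeros of a set-valued operator. -/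
def zer (A : X → Set X) : Set X := {x | (0 : X) ∈ A x}

/-- Monotone set-valued operators. -/
def IsMonotoneOp (A : X → Set X) : Prop :=
  ∀ x y u w, u ∈ A x → w ∈ A y → 0 ≤ inner ℝ (x - y) (u - w)

/-- Maximally monotone operators: no proper monotone extension of the graph. -/
def IsMaxMonotoneOp (A : X → Set X) : Prop :=
  IsMonotoneOp A ∧
    ∀ A' : X → Set X, IsMonotoneOp A' → (∀ x, A x ⊆ A' x) → A' = A

/-- Paramonotone operators. -/
def IsParamonotoneOp (A : X → Set X) : Prop :=
  IsMonotoneOp A ∧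
    ∀ x y u w, u ∈ A x → w ∈ A y → inner ℝ (x - y) (u - w) = 0 → w ∈ A x ∧ u ∈ A y

open Classical in
/-- The resolvent `J_A = (Id + A)⁻¹`: `J_A x` is the point `p` with `x ∈ p + A p`
(the value `0` is used when there is no such point, which never happens for a maximally
monotone operator on a Hilbert space). -/
noncomputable def opResolvent (A : X → Set X) (x : X) : X :=
  if h : ∃ p, p ∈ opInv (opAdd (fun y => {y}) A) x then h.choose else 0

/-- The reflected resolvent `R_A = 2 J_A - Id`. -/
noncomputable def reflResolvent (A : X → Set X) (x : X) : X :=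
  (2 : ℝ) • opResolvent A x - x

/-- The Douglas--Rachford operator `T = Id - J_A + J_B R_A`. -/
noncomputable def drOp (A B : X → Set X) (x : X) : X :=
  x - opResolvent A x + opResolvent B (reflResolvent A x)

open Classical in
/-- The projection of `x` onto `C`: the point of `C` nearest to `x`
(the value `0` is used when there is no such point, which never happens for a nonempty
closed convex subset of a Hilbert space). -/
noncomputable def setProj (C : Set X) (x : X) : X :=
  if h : ∃ p ∈ C, ∀ y ∈ C, ‖x - p‖ ≤ ‖x - y‖ then h.choose else 0

/-- The set `D = dom A - dom B`. -/
def setD (A B : X → Set X) : Set X := {d | ∃ a ∈ opDom A, ∃ b ∈ opDom B, d = a - b}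

/-- The set `R = ran A + ran B`. -/
def setR (A B : X → Set X) : Set X := {r | ∃ a ∈ opRan A, ∃ b ∈ opRan B, r = a + b}

/-- The range of the displacement mapping `Id - T`. -/
def ranDispl (A B : X → Set X) : Set X := Set.range fun x => x - drOp A B x

/-- The minimal displacement vector `v`. -/
noncomputable def vMin (A B : X → Set X) : X := setProj (closure (ranDispl A B)) 0

/-- The vector `v_D`, the projection of `0` onto the closure of `D`. -/
noncomputable def vD (A B : X → Set X) : X := setProj (closure (setD A B)) 0

/-- The vector `v_R`, the projection of `0` onto the closure of `R`. -/
noncomputable def vR (A B : X → Set X) : X := setProj (closure (setR A B)) 0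

/-- The fixed point set of `v + T`. -/
noncomputable def fixVT (A B : X → Set X) : Set X :=
  Function.fixedPoints fun x => vMin A B + drOp A B x

/-! ### The normal problem, its dual and the extended solution set -/

/-- The operator `w + A`. -/
def outShift (w : X) (A : X → Set X) : X → Set X := fun x => (fun u => w + u) '' A x

/-- The operator `B(· - w)`. -/
def inShift (B : X → Set X) (w : X) : X → Set X := fun x => B (x - w)

/-- The operator `(-Id) ∘ C ∘ (-Id)`. -/
def opVee (C : X → Set X) : X → Set X := fun x => (fun u => -u) '' C (-x)

/-- Primal solutions of the pair `(A, B)`: the zeros of `A + B`. -/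
def primalSol (A B : X → Set X) : Set X := zer (opAdd A B)

/-- Attouch--Théra dual solutions of the pair `(A, B)`: the zeros of
`A⁻¹ + (-Id) ∘ B⁻¹ ∘ (-Id)`. -/
def dualSol (A B : X → Set X) : Set X := zer (opAdd (opInv A) (opVee (opInv B)))

/-- The extended solution set of the pair `(A, B)`. -/
def extSol (A B : X → Set X) : Set (X × X) := {p | -p.2 ∈ B p.1 ∧ p.2 ∈ A p.1}

/-- `Z`: the primal solutions of the normal problem. -/
noncomputable def normalZ (A B : X → Set X) : Set X :=
  primalSol (outShift (-vMin A B) A) (inShift B (vMin A B))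

/-- `K`: the dual solutions of the normal problem. -/
noncomputable def normalK (A B : X → Set X) : Set X :=
  dualSol (outShift (-vMin A B) A) (inShift B (vMin A B))

/-- `S`: the extended solution set of the normal problem. -/
noncomputable def normalS (A B : X → Set X) : Set (X × X) :=
  extSol (outShift (-vMin A B) A) (inShift B (vMin A B))

/-- The shifted shadow sequence `(J_A Tⁿ x + n v_R, J_{A⁻¹} Tⁿ x + n v_D)` in the Hilbert
product space `X × X`. -/
noncomputable def shiftedShadow (A B : X → Set X) (x : X) (n : ℕ) : WithLp 2 (X × X) :=
  WithLp.toLp 2 (opResolvent A ((drOp A B)^[n] x) + (n : ℝ) • vR A B,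
    opResolvent (opInv A) ((drOp A B)^[n] x) + (n : ℝ) • vD A B)

end Operators

/-- Fejér monotonicity of a sequence with respect to a nonempty set. -/
def IsFejerMonotone {H : Type*} [NormedAddCommGroup H] (C : Set H) (s : ℕ → H) : Prop :=
  C.Nonempty ∧ ∀ c ∈ C, ∀ n, ‖s (n + 1) - c‖ ≤ ‖s n - c‖

end DouglasRachford

open Filter DouglasRachford

open Filter DouglasRachford

namespace DouglasRachford

/-! The engine is a pair of inequalities. Write `P x = (J_A x, J_{A⁻¹} x)`; its two entries add up
to `x`. Monotonicity of `A` and of `B` gives `‖Tx - Ty‖ ≤ ‖P x - P y‖ ≤ ‖x - y‖`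
(`norm_sq_drOp_sub_le`, `norm_sq_resolvent_sub_le`), so `‖P Tⁿx - P Tⁿf‖` decreases in `n` for any
`x` and `f`. If `f ∈ Fix (v + T)`, then `P Tⁿf = P f - n (v_R, v_D)` (`iterate_drOp_of_mem_fixVT`),
so this quantity is the distance from the shifted shadow sequence to `P f`. That is Fejér
monotonicity; boundedness and the growth statements follow from it.

The motion of `P Tⁿf` rests on the geometry of `v`. The vectors `±v_D` and `±v_R` are recession
directions of closures of ranges and domains of `A` and `B`. This yields `v_D ⊥ v_R` and, with the
range hypothesis, `v = v_D + v_R` (`vMin_eq_and_le`). The variational inequalities for `v_D` and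
`v_R` then leave no freedom for one step of the orbit (`resolvent_drOp_of_mem_fixVT`).

Underneath lie Minty's theorem, proved by minimizing the Fitzpatrick function plus half the squared
norm, and the convexity of the closures of domain and range. The set `S` is the image of `Fix (v +
T)` under `P`, translated by `(0, -v)`, and equals `Z × K` in the paramonotone case. -/

/-! ### Minimizing a strongly convex function -/

/-- A supremum of affine functions plus half the squared norm attains its infimum, with quadratic
growth at the minimizer. -/
theorem exists_minimizer_sup_affine_add_half_sq {H ι : Type*} [NormedAddCommGroup H]
    [InnerProductSpace ℝ H] [CompleteSpace H] (c : ι → H) (d : ι → ℝ)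
    (hbdd : ∀ t p, (∀ i, inner ℝ (c i) p + d i + ‖p‖ ^ 2 / 2 ≤ t) → 0 ≤ t)
    (hne : ∃ t p, ∀ i, inner ℝ (c i) p + d i + ‖p‖ ^ 2 / 2 ≤ t) :
    ∃ m p₀, (∀ i, inner ℝ (c i) p₀ + d i + ‖p₀‖ ^ 2 / 2 ≤ m) ∧
      ∀ s p, (∀ i, inner ℝ (c i) p + d i + ‖p‖ ^ 2 / 2 ≤ s) → m + ‖p - p₀‖ ^ 2 / 2 ≤ s := by
  -- Sublevel sets stand in for the function itself, whose supremum may be `+∞` at some points.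
  set S : ℝ → Set H := fun t => {p | ∀ i, inner ℝ (c i) p + d i + ‖p‖ ^ 2 / 2 ≤ t} with hS
  set V : Set ℝ := {t | (S t).Nonempty} with hV
  have hVbdd : BddBelow V := ⟨0, fun t ⟨p, hp⟩ => hbdd t p hp⟩
  have hVne : V.Nonempty := hne
  set m := sInf V with hm
  have hle : ∀ t p, p ∈ S t → m ≤ t := fun t p hp => csInf_le hVbdd ⟨p, hp⟩
  have hmono : ∀ s t p, s ≤ t → p ∈ S s → p ∈ S t := fun s t p h hp i => (hp i).trans h
  have hconv : ∀ (l s t : ℝ) (p q : H), 0 ≤ l → l ≤ 1 → p ∈ S s → q ∈ S t →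
      m + l * (1 - l) * ‖p - q‖ ^ 2 / 2 ≤ l * s + (1 - l) * t := by
    intro l s t p q h0 h1 hp hq
    have : l • p + (1 - l) • q ∈ S (l * s + (1 - l) * t - l * (1 - l) * ‖p - q‖ ^ 2 / 2) := by
      intro i
      have e : ‖l • p + (1 - l) • q‖ ^ 2
          = l * ‖p‖ ^ 2 + (1 - l) * ‖q‖ ^ 2 - l * (1 - l) * ‖p - q‖ ^ 2 := by
        rw [norm_add_sq_real, norm_sub_sq_real, norm_smul, norm_smul, mul_pow, mul_pow,
          real_inner_smul_left, real_inner_smul_right, Real.norm_eq_abs, Real.norm_eq_abs,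
          sq_abs, sq_abs]
        ring
      have h2 := mul_le_mul_of_nonneg_left (hp i) h0
      have h3 := mul_le_mul_of_nonneg_left (hq i) (sub_nonneg.2 h1)
      rw [e, inner_add_right, real_inner_smul_right, real_inner_smul_right]
      linarith
    linarith [hle _ _ this]
  have hseq : ∀ n : ℕ, ∃ p, p ∈ S (m + 1 / ((n : ℝ) + 1)) := by
    intro n
    obtain ⟨t, ⟨p, hp⟩, ht⟩ := exists_lt_of_csInf_lt hVne
      (show sInf V < m + 1 / ((n : ℝ) + 1) by
        have : (0 : ℝ) < 1 / ((n : ℝ) + 1) := by positivity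
        linarith)
    exact ⟨p, hmono _ _ _ ht.le hp⟩
  choose p hp using hseq
  have hlim0 := tendsto_one_div_add_atTop_nhds_zero_nat (𝕜 := ℝ)
  have hcauchy : CauchySeq p := by
    -- At the midpoint, strong convexity gives `‖p n - p k‖² / 8 ≤ 1 / (N + 1)`.
    refine cauchySeq_of_le_tendsto_0 (fun N : ℕ => √(8 * (1 / ((N : ℝ) + 1)))) ?_ ?_
    · intro n k N hn hk
      rw [dist_eq_norm]
      refine Real.le_sqrt_of_sq_le ?_
      have h1 : p n ∈ S (m + 1 / ((N : ℝ) + 1)) :=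
        hmono _ _ _ (by gcongr) (hp n)
      have h2 : p k ∈ S (m + 1 / ((N : ℝ) + 1)) :=
        hmono _ _ _ (by gcongr) (hp k)
      have := hconv (1 / 2) _ _ _ _ (by norm_num) (by norm_num) h1 h2
      linarith
    · have := (hlim0.const_mul 8).sqrt
      simpa using this
  obtain ⟨p₀, hp₀⟩ := cauchySeq_tendsto_of_complete hcauchy
  have hmin : p₀ ∈ S m := by
    intro i
    have h1 : Tendsto (fun n => inner ℝ (c i) (p n) + d i + ‖p n‖ ^ 2 / 2) atTop
        (nhds (inner ℝ (c i) p₀ + d i + ‖p₀‖ ^ 2 / 2)) :=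
      (Continuous.tendsto (by fun_prop :
        Continuous fun q : H => inner ℝ (c i) q + d i + ‖q‖ ^ 2 / 2) p₀).comp hp₀
    have h2 : Tendsto (fun n : ℕ => m + 1 / ((n : ℝ) + 1)) atTop (nhds m) := by
      simpa using hlim0.const_add m
    exact le_of_tendsto_of_tendsto' h1 h2 fun n => hp n i
  refine ⟨m, p₀, hmin, fun s q hq => ?_⟩
  -- Compare `p₀` with the point at fraction `l = 1 / (n + 1)` of the way to `q`, and divide by `l`;
  -- letting `l → 0` recovers the full constant `1 / 2`.
  have h1 : ∀ n : ℕ, m + (1 - 1 / ((n : ℝ) + 1)) * ‖q - p₀‖ ^ 2 / 2 ≤ s := by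
    intro n
    have hl : (0 : ℝ) < 1 / ((n : ℝ) + 1) := by positivity
    have hl1 : 1 / ((n : ℝ) + 1) ≤ 1 := by
      rw [div_le_one (by positivity)]
      linarith [n.cast_nonneg (α := ℝ)]
    have := hconv _ _ _ _ _ hl.le hl1 hq hmin
    refine le_of_mul_le_mul_left ?_ hl
    linarith
  have h2 : Tendsto (fun n : ℕ => m + (1 - 1 / ((n : ℝ) + 1)) * ‖q - p₀‖ ^ 2 / 2) atTop
      (nhds (m + (1 - 0) * ‖q - p₀‖ ^ 2 / 2)) :=
    (((hlim0.const_sub 1).mul_const _).div_const _).const_add m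
  simpa using le_of_tendsto' h2 h1

/-! ### Maximal monotonicity and Minty's theorem -/

theorem opDom_opInv {X : Type*} (A : X → Set X) : opDom (opInv A) = opRan A := by
  ext u
  simp [opDom, opInv, opRan, Set.Nonempty]

theorem opRan_opInv {X : Type*} (A : X → Set X) : opRan (opInv A) = opDom A := by
  ext u
  simp [opDom, opInv, opRan, Set.Nonempty]

section Operators

variable {X : Type*} [NormedAddCommGroup X] [InnerProductSpace ℝ X]

theorem IsMaxMonotoneOp.mem_of_forall {A : X → Set X} (hA : IsMaxMonotoneOp A) {x u : X}
    (h : ∀ a b, b ∈ A a → 0 ≤ inner ℝ (x - a) (u - b)) : u ∈ A x := by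
  have := hA.2 (fun y => A y ∪ {w | y = x ∧ w = u}) ?_ fun y => Set.subset_union_left
  · rw [← this]
    exact Or.inr ⟨rfl, rfl⟩
  · rintro a a' b b' (hb | ⟨rfl, rfl⟩) (hb' | ⟨rfl, rfl⟩)
    · exact hA.1 _ _ _ _ hb hb'
    · have := h a b hb
      rwa [← neg_sub a, ← neg_sub b, inner_neg_neg] at this
    · exact h a' b' hb'
    · simp

theorem isMaxMonotoneOp_iff {A : X → Set X} : IsMaxMonotoneOp A ↔ IsMonotoneOp A ∧
    ∀ x u, (∀ a b, b ∈ A a → 0 ≤ inner ℝ (x - a) (u - b)) → u ∈ A x := by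
  refine ⟨fun h => ⟨h.1, fun _ _ => h.mem_of_forall⟩, fun h => ⟨h.1, fun A' hA' hsub => ?_⟩⟩
  ext x u
  exact ⟨fun hu => h.2 x u fun a b hb => hA' _ _ _ _ hu (hsub _ hb), fun hu => hsub _ hu⟩

theorem IsMaxMonotoneOp.opInv {A : X → Set X} (hA : IsMaxMonotoneOp A) :
    IsMaxMonotoneOp (opInv A) := by
  rw [isMaxMonotoneOp_iff]
  refine ⟨fun x y u w hu hw => ?_, fun x u h => hA.mem_of_forall fun a b hb => ?_⟩
  · rw [real_inner_comm]
    exact hA.1 _ _ _ _ hu hw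
  · rw [real_inner_comm]
    exact h b a hb

theorem IsMaxMonotoneOp.exists_mem {A : X → Set X} (hA : IsMaxMonotoneOp A) :
    ∃ x u, u ∈ A x := by
  by_contra! h
  exact h 0 0 (hA.mem_of_forall fun a b hb => (h a b hb).elim)

/-- The key case of Minty's theorem. -/
theorem IsMaxMonotoneOp.exists_neg_mem [CompleteSpace X] {A : X → Set X}
    (hA : IsMaxMonotoneOp A) : ∃ x, -x ∈ A x := by
  let G := {p : X × X // p.2 ∈ A p.1}
  -- The supremum is the Fitzpatrick function, which by maximality is at least `⟪x, u⟫` at `(x, u)`;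
  -- half the squared norm completes the square.
  have key : ∀ (t : ℝ) (p : WithLp 2 (X × X)),
      (∀ i : G, inner ℝ (WithLp.toLp 2 (i.1.2, i.1.1) : WithLp 2 (X × X)) p
        + -inner ℝ i.1.1 i.1.2 + ‖p‖ ^ 2 / 2 ≤ t) → ‖p.fst + p.snd‖ ^ 2 / 2 ≤ t := by
    intro t p hp
    by_contra! hlt
    have hpos : ∀ a b, b ∈ A a → 0 < inner ℝ (p.fst - a) (p.snd - b) := by
      intro a b hb
      have := hp ⟨(a, b), hb⟩
      simp only [WithLp.prod_inner_apply, WithLp.prod_norm_sq_eq_of_L2] at this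
      change inner ℝ b p.fst + inner ℝ a p.snd + -inner ℝ a b + _ ≤ t at this
      rw [norm_add_sq_real] at hlt
      rw [inner_sub_left, inner_sub_right, inner_sub_right, real_inner_comm b p.fst]
      linarith
    have := hpos _ _ (hA.mem_of_forall fun a b hb => (hpos a b hb).le)
    simp at this
  obtain ⟨a₀, b₀, h₀⟩ := hA.exists_mem
  have hgraph : ∀ a b, b ∈ A a → ∀ i : G,
      inner ℝ (WithLp.toLp 2 (i.1.2, i.1.1) : WithLp 2 (X × X)) (WithLp.toLp 2 (a, b))
        + -inner ℝ i.1.1 i.1.2 + ‖(WithLp.toLp 2 (a, b) : WithLp 2 (X × X))‖ ^ 2 / 2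
        ≤ ‖a + b‖ ^ 2 / 2 := by
    rintro a b hb ⟨⟨a', b'⟩, hb'⟩
    have := hA.1 _ _ _ _ hb hb'
    simp only [WithLp.prod_inner_apply, WithLp.prod_norm_sq_eq_of_L2]
    change inner ℝ b' a + inner ℝ a' b + -inner ℝ a' b' + (‖a‖ ^ 2 + ‖b‖ ^ 2) / 2 ≤ _
    change 0 ≤ inner ℝ (a - a') (b - b') at this
    rw [norm_add_sq_real]
    rw [inner_sub_left, inner_sub_right, inner_sub_right, real_inner_comm b' a] at this
    linarith
  obtain ⟨m, p, hp, hmin⟩ := exists_minimizer_sup_affine_add_half_sq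
    (fun i : G => (WithLp.toLp 2 (i.1.2, i.1.1) : WithLp 2 (X × X)))
    (fun i => -inner ℝ i.1.1 i.1.2)
    (fun t p hp => le_trans (by positivity) (key t p hp))
    ⟨_, _, hgraph _ _ h₀⟩
  have hm := key m p hp
  -- At a graph point the objective is at most `‖a + b‖² / 2`. Quadratic growth around the minimizer
  -- `p`, together with `hm`, says that `(-p.snd, -p.fst)` is monotonically related to the graph;
  -- testing it against itself then forces `p.fst + p.snd = 0`.
  have hrel : ∀ a b, b ∈ A a →
      ‖p.fst + p.snd‖ ^ 2 ≤ inner ℝ (-p.snd - a) (-p.fst - b) := by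
    intro a b hb
    have h := hmin _ _ (hgraph a b hb)
    simp only [WithLp.prod_norm_sq_eq_of_L2, WithLp.sub_fst, WithLp.sub_snd] at h
    change m + (‖a - p.fst‖ ^ 2 + ‖b - p.snd‖ ^ 2) / 2 ≤ _ at h
    rw [norm_add_sq_real a b, norm_sub_sq_real, norm_sub_sq_real] at h
    rw [norm_add_sq_real] at hm ⊢
    rw [inner_sub_left, inner_sub_right, inner_sub_right, inner_neg_neg, inner_neg_left,
      inner_neg_right, real_inner_comm p.fst p.snd, real_inner_comm b p.snd]
    linarith
  have hmem : -p.fst ∈ A (-p.snd) :=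
    hA.mem_of_forall fun a b hb => le_trans (by positivity) (hrel a b hb)
  have h0 := hrel _ _ hmem
  simp only [sub_self, inner_zero_left] at h0
  have h1 : p.fst + p.snd = 0 := by
    rw [← norm_eq_zero]
    exact pow_eq_zero_iff two_ne_zero |>.1 (le_antisymm h0 (by positivity))
  rw [← eq_neg_iff_add_eq_zero] at h1
  exact ⟨p.fst, by rwa [← h1] at hmem⟩

/-- Minty's theorem. -/
theorem IsMaxMonotoneOp.exists_smul_add [CompleteSpace X] {A : X → Set X}
    (hA : IsMaxMonotoneOp A) {ε : ℝ} (hε : 0 < ε) (z : X) :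
    ∃ x, ∃ u ∈ A x, ε • x + u = z := by
  -- Apply the key case to `ε⁻¹ (A - z)`.
  have h : IsMaxMonotoneOp fun x => {w | z + ε • w ∈ A x} := by
    rw [isMaxMonotoneOp_iff]
    refine ⟨fun x y u w hu hw => ?_, fun x u h => hA.mem_of_forall fun a b hb => ?_⟩
    · have := hA.1 _ _ _ _ hu hw
      rw [add_sub_add_left_eq_sub, ← smul_sub, real_inner_smul_right] at this
      exact nonneg_of_mul_nonneg_right this hε
    · have := h a (ε⁻¹ • (b - z)) (by simpa [smul_smul, hε.ne'] using hb)
      have e : z + ε • u - b = ε • (u - ε⁻¹ • (b - z)) := by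
        rw [smul_sub, smul_smul, mul_inv_cancel₀ hε.ne', one_smul]
        abel
      rw [e, real_inner_smul_right]
      positivity
  obtain ⟨x, hx⟩ := h.exists_neg_mem
  exact ⟨x, _, hx, by simp⟩

theorem IsMaxMonotoneOp.exists_add_smul [CompleteSpace X] {A : X → Set X}
    (hA : IsMaxMonotoneOp A) {ε : ℝ} (hε : 0 < ε) (z : X) :
    ∃ x, ∃ u ∈ A x, x + ε • u = z := by
  obtain ⟨u, x, hx, h⟩ := hA.opInv.exists_smul_add hε z
  exact ⟨x, u, hx, by rw [← h, add_comm]⟩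

/-! ### Recession directions of the range and convexity of the closed domain -/

/-- Solve `ε x + w = u + y + ε a` with `w ∈ A x`. The error `u + y - w` is `ε (x - a)`, and
monotonicity bounds its square by `ε (M - ⟪a, y⟫)`, which vanishes with `ε`. -/
theorem IsMaxMonotoneOp.add_mem_closure_opRan [CompleteSpace X] {A : X → Set X}
    (hA : IsMaxMonotoneOp A) {y : X} {M : ℝ} (hy : ∀ x ∈ opDom A, inner ℝ x y ≤ M) {u : X}
    (hu : u ∈ opRan A) : u + y ∈ closure (opRan A) := by
  obtain ⟨a, ha⟩ := Set.mem_iUnion.1 hu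
  rw [Metric.mem_closure_iff]
  intro δ hδ
  set K := M - inner ℝ a y with hK
  have hK0 : 0 ≤ K := sub_nonneg.2 (hy a ⟨u, ha⟩)
  set ε := δ ^ 2 / (K + 1) with hε
  have hε0 : 0 < ε := by positivity
  obtain ⟨x, w, hw, hxw⟩ := hA.exists_smul_add hε0 (u + y + ε • a)
  refine ⟨w, Set.mem_iUnion.2 ⟨x, hw⟩, ?_⟩
  have e : u + y - w = ε • (x - a) := by
    rw [smul_sub, sub_eq_sub_iff_add_eq_add, hxw]
  have h1 := hA.1 _ _ _ _ hw ha
  have e2 : w - u = y - ε • (x - a) := by rw [← e]; abel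
  rw [e2, inner_sub_right, real_inner_smul_right, real_inner_self_eq_norm_sq,
    inner_sub_left] at h1
  have h2 := hy x ⟨w, hw⟩
  have h3 : ε * ‖x - a‖ ^ 2 ≤ K := by linarith
  rw [dist_eq_norm, e]
  refine lt_of_pow_lt_pow_left₀ 2 hδ.le ?_
  rw [norm_smul, mul_pow, Real.norm_eq_abs, sq_abs]
  calc ε ^ 2 * ‖x - a‖ ^ 2 = ε * (ε * ‖x - a‖ ^ 2) := by ring
    _ ≤ ε * K := by gcongr
    _ < ε * (K + 1) := by gcongr; linarith
    _ = δ ^ 2 := by rw [hε]; field_simp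

theorem convex_closure_of_forall_mem {s : Set X}
    (h : ∀ x ∈ s, ∀ y ∈ s, ∀ a b : ℝ, 0 ≤ a → 0 ≤ b → a + b = 1 → a • x + b • y ∈ closure s) :
    Convex ℝ (closure s) := by
  intro x hx y hy a b ha hb hab
  have := map_mem_closure₂ (f := fun x y : X => a • x + b • y) (u := closure s) (by fun_prop)
    hx hy fun x hx y hy => h x hx y hy a b ha hb hab
  rwa [closure_closure] at this

/-- The points `J_{εA} c` lie in the domain and tend to `c` as `ε → 0` when `c` is a convex
combination of domain points: average the monotonicity inequalities against the two endpoints. -/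
theorem IsMaxMonotoneOp.convex_closure_opDom [CompleteSpace X] {A : X → Set X}
    (hA : IsMaxMonotoneOp A) : Convex ℝ (closure (opDom A)) := by
  refine convex_closure_of_forall_mem ?_
  rintro a₀ ⟨u₀, h₀⟩ a₁ ⟨u₁, h₁⟩ l k hl hk hlk
  set c := l • a₀ + k • a₁ with hc
  set g := l • u₀ + k • u₁ with hg
  set C : ℝ := l * inner ℝ (a₀ - c) u₀ + k * inner ℝ (a₁ - c) u₁ with hC
  rw [Metric.mem_closure_iff]
  intro δ hδ
  -- `‖x - c‖² ≤ ε (C - ⟪x - c, g⟫)` for the approximants `x`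
  have key : ∀ ε : ℝ, 0 < ε → ∃ x ∈ opDom A,
      ‖x - c‖ ^ 2 ≤ ε * (C - inner ℝ (x - c) g) := by
    intro ε hε
    obtain ⟨x, w, hw, hxw⟩ := hA.exists_add_smul hε c
    refine ⟨x, ⟨w, hw⟩, ?_⟩
    have e0 := mul_nonneg (mul_nonneg hε.le hl) (hA.1 _ _ _ _ hw h₀)
    have e1 := mul_nonneg (mul_nonneg hε.le hk) (hA.1 _ _ _ _ hw h₁)
    have e2 : inner ℝ (x - c) (ε • w) = -‖x - c‖ ^ 2 := by
      rw [show ε • w = -(x - c) by rw [← hxw]; abel, inner_neg_right,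
        real_inner_self_eq_norm_sq]
    have e3 : l • (x - a₀) + k • (x - a₁) = x - c := by
      have : l • x + k • x = x := by rw [← add_smul, hlk, one_smul]
      rw [smul_sub, smul_sub, hc, sub_add_sub_comm, this]
    have e4 : l * inner ℝ (x - a₀) w + k * inner ℝ (x - a₁) w = inner ℝ (x - c) w := by
      rw [← e3, inner_add_left, real_inner_smul_left, real_inner_smul_left]
    have e5 : l * inner ℝ (x - a₀) u₀ + k * inner ℝ (x - a₁) u₁
        = inner ℝ (x - c) g - C := by
      rw [show x - a₀ = (x - c) - (a₀ - c) by abel, show x - a₁ = (x - c) - (a₁ - c) by abel,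
        hg, hC, inner_add_right, real_inner_smul_right, real_inner_smul_right,
        inner_sub_left (x - c), inner_sub_left (x - c)]
      ring
    rw [inner_sub_right] at e0 e1
    rw [real_inner_smul_right, ← e4] at e2
    have e6 := congrArg (fun r => ε * r) e5
    linarith
  set G := ‖g‖ with hG
  -- With this `ε`, a distance `r ≥ δ` would give `2 r² (|C| + G δ + 1) ≤ r² (|C| + G δ)`.
  obtain ⟨x, hx, h⟩ := key (δ ^ 2 / (2 * (|C| + G * δ + 1))) (by positivity)
  refine ⟨x, hx, ?_⟩
  rw [dist_comm, dist_eq_norm]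
  by_contra! hge
  have hin : C - inner ℝ (x - c) g ≤ |C| + ‖x - c‖ * G := by
    have h1 := le_abs_self C
    have h2 := abs_real_inner_le_norm (x - c) g
    have h3 := neg_abs_le (inner ℝ (x - c) g)
    linarith
  have h1 : ‖x - c‖ ^ 2 * (2 * (|C| + G * δ + 1)) ≤ δ ^ 2 * (|C| + ‖x - c‖ * G) := by
    rw [div_mul_eq_mul_div, le_div_iff₀ (by positivity)] at h
    exact h.trans (by gcongr)
  set r := ‖x - c‖ with hr
  have hG0 : 0 ≤ G := norm_nonneg g
  have hr0 : 0 < r := hδ.trans_le hge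
  have h2 : δ ^ 2 * |C| ≤ r ^ 2 * |C| := by gcongr
  have h3 : δ ^ 2 * (r * G) ≤ r ^ 2 * (G * δ) := by
    have : δ * r * G * δ ≤ δ * r * G * r := by gcongr
    linarith
  have h4 : 0 ≤ r ^ 2 * (|C| + G * δ) := by positivity
  have h5 : 0 < r ^ 2 := by positivity
  linarith

/-! ### Resolvents, and projections of the origin -/

theorem IsMonotoneOp.opResolvent_eq {A : X → Set X} (hA : IsMonotoneOp A) {x u : X}
    (hu : u ∈ A x) : opResolvent A (x + u) = x := by
  have h : ∃ p, p ∈ opInv (opAdd (fun y => {y}) A) (x + u) := ⟨x, x, rfl, u, hu, rfl⟩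
  rw [opResolvent, dif_pos h]
  obtain ⟨y, hy, w, hw, he⟩ := h.choose_spec
  rw [Set.mem_singleton_iff] at hy
  rw [← hy]
  rw [← hy] at hw
  have e : u - w = -(x - y) := by
    rw [eq_neg_iff_add_eq_zero, sub_add_sub_comm, add_comm u, he, add_comm w, sub_self]
  have := hA _ _ _ _ hu hw
  rw [e, inner_neg_right, real_inner_self_eq_norm_sq] at this
  have h0 : ‖x - y‖ = 0 := pow_eq_zero_iff two_ne_zero |>.1
    (le_antisymm (by linarith) (by positivity))
  exact (sub_eq_zero.1 (norm_eq_zero.1 h0)).symm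

theorem IsMonotoneOp.opInv {A : X → Set X} (hA : IsMonotoneOp A) : IsMonotoneOp (opInv A) :=
  fun x y u w hu hw => by
    rw [real_inner_comm]
    exact hA _ _ _ _ hu hw

theorem IsMonotoneOp.opResolvent_opInv_eq {A : X → Set X} (hA : IsMonotoneOp A) {x u : X}
    (hu : u ∈ A x) : opResolvent (DouglasRachford.opInv A) (x + u) = u := by
  rw [add_comm]
  exact hA.opInv.opResolvent_eq hu

theorem IsMaxMonotoneOp.resolvent_add [CompleteSpace X] {A : X → Set X}
    (hA : IsMaxMonotoneOp A) (z : X) :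
    opResolvent A z + opResolvent (DouglasRachford.opInv A) z = z := by
  obtain ⟨x, u, hu, rfl⟩ := hA.exists_smul_add one_pos z
  rw [one_smul, hA.1.opResolvent_eq hu, hA.1.opResolvent_opInv_eq hu]

theorem IsMaxMonotoneOp.resolvent_mem [CompleteSpace X] {A : X → Set X}
    (hA : IsMaxMonotoneOp A) (z : X) :
    opResolvent (DouglasRachford.opInv A) z ∈ A (opResolvent A z) := by
  obtain ⟨x, u, hu, rfl⟩ := hA.exists_smul_add one_pos z
  rwa [one_smul, hA.1.opResolvent_eq hu, hA.1.opResolvent_opInv_eq hu]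

/-- The variational inequality for the projection of `0`. -/
theorem setProj_zero_mem_and_le [CompleteSpace X] {C : Set X} (hne : C.Nonempty)
    (hcl : IsClosed C) (hconv : Convex ℝ C) :
    setProj C 0 ∈ C ∧ ∀ w ∈ C, ‖setProj C 0‖ ^ 2 ≤ inner ℝ w (setProj C 0) := by
  have h : ∃ p ∈ C, ∀ y ∈ C, ‖(0 : X) - p‖ ≤ ‖(0 : X) - y‖ := by
    obtain ⟨p, hp, he⟩ := exists_norm_eq_iInf_of_complete_convex hne hcl.isComplete hconv 0
    refine ⟨p, hp, fun y hy => ?_⟩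
    rw [he]
    exact ciInf_le ⟨0, by rintro _ ⟨w, rfl⟩; exact norm_nonneg _⟩ (⟨y, hy⟩ : C)
  rw [setProj, dif_pos h]
  obtain ⟨hp, hmin⟩ := h.choose_spec
  set p := h.choose
  refine ⟨hp, fun w hw => ?_⟩
  have e : ‖(0 : X) - p‖ = ⨅ w : C, ‖(0 : X) - w‖ := by
    have : Nonempty C := ⟨⟨p, hp⟩⟩
    exact le_antisymm (le_ciInf fun w => hmin w w.2)
      (ciInf_le ⟨0, by rintro _ ⟨w, rfl⟩; exact norm_nonneg _⟩ (⟨p, hp⟩ : C))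
  have := (norm_eq_iInf_iff_real_inner_le_zero hconv hp).1 e w hw
  rw [zero_sub, inner_neg_left, inner_sub_right, real_inner_self_eq_norm_sq,
    real_inner_comm] at this
  linarith

theorem eq_of_norm_le_of_sq_le_inner {p v : X} (h : ‖p‖ ≤ ‖v‖) (hv : ‖v‖ ^ 2 ≤ inner ℝ p v) :
    p = v := by
  rw [← sub_eq_zero, ← norm_eq_zero, ← sq_eq_zero_iff]
  refine le_antisymm ?_ (by positivity)
  rw [norm_sub_sq_real]
  have : ‖p‖ ^ 2 ≤ ‖v‖ ^ 2 := by gcongr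
  linarith

theorem setProj_zero_eq {C : Set X} {v : X} (hv : v ∈ C)
    (h : ∀ w ∈ C, ‖v‖ ^ 2 ≤ inner ℝ w v) : setProj C 0 = v := by
  have hex : ∃ p ∈ C, ∀ y ∈ C, ‖(0 : X) - p‖ ≤ ‖(0 : X) - y‖ := by
    refine ⟨v, hv, fun y hy => ?_⟩
    rw [zero_sub, zero_sub, norm_neg, norm_neg]
    have h1 := (h y hy).trans (real_inner_le_norm y v)
    rcases (norm_nonneg v).eq_or_lt with h0 | h0
    · rw [← h0]; exact norm_nonneg y
    · exact le_of_mul_le_mul_right (by rwa [← sq]) h0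
  rw [setProj, dif_pos hex]
  obtain ⟨hp, hmin⟩ := hex.choose_spec
  have := hmin v hv
  rw [zero_sub, zero_sub, norm_neg, norm_neg] at this
  exact eq_of_norm_le_of_sq_le_inner this (h _ hp)

end Operators

/-! ### The decomposition of the minimal displacement vector -/

section Displacement

variable {X : Type*} [NormedAddCommGroup X] [InnerProductSpace ℝ X]

theorem convex_closure_add_smul {S T : Set X} (hS : Convex ℝ (closure S))
    (hT : Convex ℝ (closure T)) (c : ℝ) :
    Convex ℝ (closure {w | ∃ a ∈ S, ∃ b ∈ T, w = a + c • b}) := by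
  refine convex_closure_of_forall_mem ?_
  rintro _ ⟨a, ha, b, hb, rfl⟩ _ ⟨a', ha', b', hb', rfl⟩ l k hl hk hlk
  have h1 := hS (subset_closure ha) (subset_closure ha') hl hk hlk
  have h2 := hT (subset_closure hb) (subset_closure hb') hl hk hlk
  have e : l • (a + c • b) + k • (a' + c • b')
      = (l • a + k • a') + c • (l • b + k • b') := by module
  rw [e]
  exact map_mem_closure₂ (f := fun x y : X => x + c • y) (by fun_prop) h1 h2
    fun x hx y hy => ⟨x, hx, y, hy, rfl⟩

theorem setD_eq (A B : X → Set X) :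
    setD A B = {w | ∃ a ∈ opDom A, ∃ b ∈ opDom B, w = a + (-1 : ℝ) • b} := by
  simp [setD, sub_eq_add_neg]

theorem setR_eq (A B : X → Set X) :
    setR A B = {w | ∃ a ∈ opRan A, ∃ b ∈ opRan B, w = a + (1 : ℝ) • b} := by
  simp [setR]

theorem sub_drOp (A B : X → Set X) (x : X) :
    x - drOp A B x = opResolvent A x - opResolvent B (reflResolvent A x) := by
  rw [drOp]
  abel

variable [CompleteSpace X] {A B : X → Set X}

theorem vD_mem_and_le (hA : IsMaxMonotoneOp A) (hB : IsMaxMonotoneOp B) :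
    vD A B ∈ closure (setD A B) ∧
      ∀ w ∈ closure (setD A B), ‖vD A B‖ ^ 2 ≤ inner ℝ w (vD A B) := by
  obtain ⟨a, u, hu⟩ := hA.exists_mem
  obtain ⟨b, w, hw⟩ := hB.exists_mem
  refine setProj_zero_mem_and_le ?_ isClosed_closure ?_
  · exact ⟨a - b, subset_closure ⟨a, ⟨u, hu⟩, b, ⟨w, hw⟩, rfl⟩⟩
  · rw [setD_eq]
    exact convex_closure_add_smul hA.convex_closure_opDom hB.convex_closure_opDom _

theorem vR_mem_and_le (hA : IsMaxMonotoneOp A) (hB : IsMaxMonotoneOp B) :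
    vR A B ∈ closure (setR A B) ∧
      ∀ w ∈ closure (setR A B), ‖vR A B‖ ^ 2 ≤ inner ℝ w (vR A B) := by
  obtain ⟨a, u, hu⟩ := hA.exists_mem
  obtain ⟨b, w, hw⟩ := hB.exists_mem
  refine setProj_zero_mem_and_le ?_ isClosed_closure ?_
  · exact ⟨u + w, subset_closure
      ⟨u, Set.mem_iUnion.2 ⟨a, hu⟩, w, Set.mem_iUnion.2 ⟨b, hw⟩, rfl⟩⟩
  · rw [setR_eq, ← opDom_opInv, ← opDom_opInv]
    exact convex_closure_add_smul hA.opInv.convex_closure_opDom hB.opInv.convex_closure_opDom _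

/-- The variational inequality for `v_D` bounds `⟪·, v_D⟫` above on `dom B`, so `v_D` is a recession
direction of the closure of `ran B`. The next two lemmas use `-v_D` on `dom A` and `-v_R` on `ran B
= dom B⁻¹` in the same way. -/
theorem vR_add_vD_mem_closure_setR (hA : IsMaxMonotoneOp A) (hB : IsMaxMonotoneOp B) :
    vR A B + vD A B ∈ closure (setR A B) := by
  obtain ⟨a₀, u₀, h₀⟩ := hA.exists_mem
  have hD := (vD_mem_and_le hA hB).2
  have := map_mem_closure (f := fun x => x + vD A B) (t := closure (setR A B)) (by fun_prop)
    (vR_mem_and_le hA hB).1 ?_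
  · rwa [closure_closure] at this
  rintro _ ⟨u, hu, w, hw, rfl⟩
  have h1 : w + vD A B ∈ closure (opRan B) := by
    refine hB.add_mem_closure_opRan (M := inner ℝ a₀ (vD A B)) (fun b hb => ?_) hw
    have := hD _ (subset_closure ⟨a₀, ⟨u₀, h₀⟩, b, hb, rfl⟩)
    rw [inner_sub_left] at this
    have h2 : 0 ≤ ‖vD A B‖ ^ 2 := by positivity
    linarith
  have := map_mem_closure (f := fun x => u + x) (t := setR A B) (by fun_prop) h1
    fun y hy => ⟨u, hu, y, hy, rfl⟩
  simpa only [add_assoc] using this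

theorem vR_sub_vD_mem_closure_setR (hA : IsMaxMonotoneOp A) (hB : IsMaxMonotoneOp B) :
    vR A B - vD A B ∈ closure (setR A B) := by
  obtain ⟨b₀, u₀, h₀⟩ := hB.exists_mem
  have hD := (vD_mem_and_le hA hB).2
  have := map_mem_closure (f := fun x => x - vD A B) (t := closure (setR A B)) (by fun_prop)
    (vR_mem_and_le hA hB).1 ?_
  · rwa [closure_closure] at this
  rintro _ ⟨u, hu, w, hw, rfl⟩
  have h1 : u + -vD A B ∈ closure (opRan A) := by
    refine hA.add_mem_closure_opRan (M := -inner ℝ b₀ (vD A B)) (fun a ha => ?_) hu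
    have := hD _ (subset_closure ⟨a, ha, b₀, ⟨u₀, h₀⟩, rfl⟩)
    rw [inner_sub_left] at this
    have h2 : 0 ≤ ‖vD A B‖ ^ 2 := by positivity
    rw [inner_neg_right]
    linarith
  have := map_mem_closure (f := fun x => x + w) (t := setR A B) (by fun_prop) h1
    fun y hy => ⟨y, hy, w, hw, rfl⟩
  rwa [← sub_eq_add_neg, sub_add_eq_add_sub] at this

theorem vD_add_vR_mem_closure_setD (hA : IsMaxMonotoneOp A) (hB : IsMaxMonotoneOp B) :
    vD A B + vR A B ∈ closure (setD A B) := by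
  obtain ⟨a₀, u₀, h₀⟩ := hA.exists_mem
  have hR := (vR_mem_and_le hA hB).2
  have := map_mem_closure (f := fun x => x + vR A B) (t := closure (setD A B)) (by fun_prop)
    (vD_mem_and_le hA hB).1 ?_
  · rwa [closure_closure] at this
  rintro _ ⟨a, ha, b, hb, rfl⟩
  have h1 : b + -vR A B ∈ closure (opRan (opInv B)) := by
    rw [← opRan_opInv] at hb
    refine hB.opInv.add_mem_closure_opRan (M := inner ℝ u₀ (vR A B)) (fun w hw => ?_) hb
    rw [opDom_opInv] at hw
    have := hR _ (subset_closure ⟨u₀, Set.mem_iUnion.2 ⟨a₀, h₀⟩, w, hw, rfl⟩)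
    rw [inner_add_left] at this
    have h2 : 0 ≤ ‖vR A B‖ ^ 2 := by positivity
    rw [inner_neg_right]
    linarith
  rw [opRan_opInv] at h1
  have := map_mem_closure (f := fun x => a - x) (t := setD A B) (by fun_prop) h1
    fun y hy => ⟨a, ha, y, hy, rfl⟩
  have e : a - (b + -vR A B) = a - b + vR A B := by abel
  rwa [e] at this

/-- Both `v_R + v_D` and `v_R - v_D` compete with the projection `v_R`, so the inner product is both
nonnegative and nonpositive. -/
theorem inner_vD_vR (hA : IsMaxMonotoneOp A) (hB : IsMaxMonotoneOp B) :
    inner ℝ (vD A B) (vR A B) = 0 := by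
  have hR := (vR_mem_and_le hA hB).2
  have h1 := hR _ (vR_add_vD_mem_closure_setR hA hB)
  have h2 := hR _ (vR_sub_vD_mem_closure_setR hA hB)
  rw [inner_add_left, real_inner_self_eq_norm_sq] at h1
  rw [inner_sub_left, real_inner_self_eq_norm_sq] at h2
  linarith

/-- The minimal displacement vector decomposes as `v = v_D + v_R`, and satisfies the
variational inequality on the closure of the range of the displacement mapping. -/
theorem vMin_eq_and_le (hA : IsMaxMonotoneOp A) (hB : IsMaxMonotoneOp B)
    (hran : closure (ranDispl A B) = closure (setD A B) ∩ closure (setR A B)) :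
    vMin A B = vD A B + vR A B ∧
      ∀ w ∈ closure (ranDispl A B), ‖vMin A B‖ ^ 2 ≤ inner ℝ w (vMin A B) := by
  have hmem : vD A B + vR A B ∈ closure (ranDispl A B) := by
    rw [hran]
    refine ⟨vD_add_vR_mem_closure_setD hA hB, ?_⟩
    rw [add_comm]
    exact vR_add_vD_mem_closure_setR hA hB
  have hle : ∀ w ∈ closure (ranDispl A B),
      ‖vD A B + vR A B‖ ^ 2 ≤ inner ℝ w (vD A B + vR A B) := by
    intro w hw
    rw [hran] at hw
    have h1 := (vD_mem_and_le hA hB).2 w hw.1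
    have h2 := (vR_mem_and_le hA hB).2 w hw.2
    rw [norm_add_sq_real, inner_vD_vR hA hB, inner_add_right]
    linarith
  have e : vMin A B = vD A B + vR A B := setProj_zero_eq hmem hle
  rw [e]
  exact ⟨rfl, hle⟩

/-! ### The Douglas–Rachford operator in terms of resolvents -/

theorem drOp_eq (hA : IsMaxMonotoneOp A) (x : X) :
    drOp A B x = opResolvent (opInv A) x + opResolvent B (reflResolvent A x) := by
  rw [drOp, eq_sub_of_add_eq' (hA.resolvent_add x)]

theorem reflResolvent_eq (hA : IsMaxMonotoneOp A) (x : X) :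
    reflResolvent A x = opResolvent A x - opResolvent (opInv A) x := by
  rw [eq_sub_of_add_eq' (hA.resolvent_add x), reflResolvent]
  module

theorem resolvent_add_reflResolvent (hA : IsMaxMonotoneOp A) (hB : IsMaxMonotoneOp B) (x : X) :
    opResolvent B (reflResolvent A x) + opResolvent (opInv B) (reflResolvent A x)
      = opResolvent A x - opResolvent (opInv A) x := by
  rw [hB.resolvent_add, reflResolvent_eq hA]

theorem inner_resolvent_sub_nonneg (hA : IsMaxMonotoneOp A) (x y : X) :
    0 ≤ inner ℝ (opResolvent A x - opResolvent A y)
      (opResolvent (opInv A) x - opResolvent (opInv A) y) :=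
  hA.1 _ _ _ _ (hA.resolvent_mem x) (hA.resolvent_mem y)

theorem norm_sq_resolvent_sub_le (hA : IsMaxMonotoneOp A) (x y : X) :
    ‖opResolvent A x - opResolvent A y‖ ^ 2
      + ‖opResolvent (opInv A) x - opResolvent (opInv A) y‖ ^ 2 ≤ ‖x - y‖ ^ 2 := by
  have h := inner_resolvent_sub_nonneg hA x y
  have e : x - y = (opResolvent A x - opResolvent A y)
      + (opResolvent (opInv A) x - opResolvent (opInv A) y) := by
    rw [sub_add_sub_comm, hA.resolvent_add, hA.resolvent_add]
  rw [congrArg norm e, norm_add_sq_real]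
  linarith

/-- With `p`, `q`, `r` the differences of `J_A`, `J_{A⁻¹}`, `J_B R_A`, monotonicity of `B` reads `0
≤ ⟪r, p - q - r⟫`; adding `0 ≤ ‖p - r‖²` bounds `‖q + r‖²`. -/
theorem norm_sq_drOp_sub_le (hA : IsMaxMonotoneOp A) (hB : IsMaxMonotoneOp B) (x y : X) :
    ‖drOp A B x - drOp A B y‖ ^ 2 ≤ ‖opResolvent A x - opResolvent A y‖ ^ 2
      + ‖opResolvent (opInv A) x - opResolvent (opInv A) y‖ ^ 2 := by
  have h := inner_resolvent_sub_nonneg hB (reflResolvent A x) (reflResolvent A y)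
  have e := congrArg₂ (· - ·) (resolvent_add_reflResolvent hA hB x)
    (resolvent_add_reflResolvent hA hB y)
  rw [drOp_eq hA, drOp_eq hA, add_sub_add_comm]
  rw [add_sub_add_comm, sub_sub_sub_comm] at e
  set p := opResolvent A x - opResolvent A y
  set q := opResolvent (opInv A) x - opResolvent (opInv A) y
  set r := opResolvent B (reflResolvent A x) - opResolvent B (reflResolvent A y)
  rw [eq_sub_of_add_eq' e, inner_sub_right, inner_sub_right, real_inner_self_eq_norm_sq] at h
  have h1 : 0 ≤ ‖p - r‖ ^ 2 := by positivity
  rw [norm_sub_sq_real, real_inner_comm] at h1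
  rw [norm_add_sq_real, real_inner_comm]
  linarith

theorem norm_drOp_sub_le (hA : IsMaxMonotoneOp A) (hB : IsMaxMonotoneOp B) (x y : X) :
    ‖drOp A B x - drOp A B y‖ ≤ ‖x - y‖ :=
  le_of_sq_le_sq ((norm_sq_drOp_sub_le hA hB x y).trans (norm_sq_resolvent_sub_le hA x y))
    (norm_nonneg _)

end Displacement

/-! ### Orbits of `Fix (v + T)`, Fejér monotonicity and the normal problem -/

section Iterates

variable {X : Type*} [NormedAddCommGroup X] [InnerProductSpace ℝ X]

theorem drOp_of_mem_fixVT {A B : X → Set X} {f : X} (hf : f ∈ fixVT A B) :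
    drOp A B f = f - vMin A B :=
  eq_sub_of_add_eq' hf

/-- Pair a primal solution with a primal point attached to the dual solution. Monotonicity of `A`
and of `B` gives opposite signs to the same inner product, so it vanishes and paramonotonicity
exchanges the images. -/
theorem normalZ_prod_normalK_eq (A B : X → Set X) (hA : IsParamonotoneOp A)
    (hB : IsParamonotoneOp B) : normalZ A B ×ˢ normalK A B = normalS A B := by
  ext ⟨z, k⟩
  constructor
  · rintro ⟨⟨a, ⟨u, hu, rfl⟩, b, hb, h0⟩, ⟨z', ⟨w, hw, hwk⟩, y, ⟨y', hy', rfl⟩, h0'⟩⟩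
    simp only at hu hw hwk hb hy' h0 h0'
    have e1 : b = -(-vMin A B + u) := eq_neg_of_add_eq_zero_right h0.symm
    have e2 : y' = z' := (add_neg_eq_zero.1 h0'.symm).symm
    subst e1 e2
    change -k ∈ B (y' - vMin A B) at hy'
    change _ ∈ B (z - vMin A B) at hb
    subst hwk
    have h1 := hA.1 _ _ _ _ hu hw
    have h2 := hB.1 _ _ _ _ hb hy'
    rw [sub_sub_sub_cancel_right, neg_sub_neg, add_sub_add_left_eq_sub, ← neg_sub u,
      inner_neg_right] at h2
    have h3 : inner ℝ (z - y') (u - w) = 0 := by linarith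
    refine ⟨(hB.2 _ _ _ _ hb hy' ?_).1, w, (hA.2 _ _ _ _ hu hw h3).1, rfl⟩
    rw [sub_sub_sub_cancel_right, neg_sub_neg, add_sub_add_left_eq_sub, ← neg_sub u,
      inner_neg_right, h3, neg_zero]
  · rintro ⟨hb, ha⟩
    exact ⟨⟨k, ha, -k, hb, (add_neg_cancel k).symm⟩,
      ⟨z, ha, -z, ⟨z, hb, rfl⟩, (add_neg_cancel z).symm⟩⟩

theorem tendsto_norm_atTop_of_isBounded_add_smul {s : ℕ → X} {w : X}
    (h : Bornology.IsBounded (Set.range fun n : ℕ => s n + (n : ℝ) • w)) (hw : w ≠ 0) :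
    Tendsto (fun n => ‖s n‖) atTop atTop := by
  obtain ⟨C, hC⟩ := isBounded_iff_forall_norm_le.1 h
  have h1 : Tendsto (fun n : ℕ => (n : ℝ) * ‖w‖ - C) atTop atTop :=
    tendsto_atTop_add_const_right _ _
      (tendsto_natCast_atTop_atTop.atTop_mul_const (norm_pos_iff.2 hw))
  refine tendsto_atTop_mono (fun n => ?_) h1
  have h2 := hC _ ⟨n, rfl⟩
  have h3 := norm_sub_le (s n + (n : ℝ) • w) (s n)
  rw [add_sub_cancel_left, norm_smul, Real.norm_natCast] at h3
  simp only at h2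
  linarith

theorem isBounded_range_iff_of_isBounded_add_smul {s : ℕ → X} {w : X}
    (h : Bornology.IsBounded (Set.range fun n : ℕ => s n + (n : ℝ) • w)) :
    Bornology.IsBounded (Set.range s) ↔ w = 0 := by
  refine ⟨fun hs => ?_, fun hw => by simpa [hw] using h⟩
  by_contra hw
  obtain ⟨C, hC⟩ := isBounded_iff_forall_norm_le.1 hs
  obtain ⟨n, hn⟩ := ((tendsto_norm_atTop_of_isBounded_add_smul h hw).eventually_gt_atTop C).exists
  exact (hC _ ⟨n, rfl⟩).not_gt hn

variable [CompleteSpace X] {A B : X → Set X}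

theorem resolvent_reflResolvent_of_mem_fixVT (hA : IsMaxMonotoneOp A) (hB : IsMaxMonotoneOp B)
    {f : X} (hf : f ∈ fixVT A B) :
    opResolvent B (reflResolvent A f) = opResolvent A f - vMin A B ∧
      opResolvent (opInv B) (reflResolvent A f) = vMin A B - opResolvent (opInv A) f := by
  have h1 := sub_drOp A B f
  rw [drOp_of_mem_fixVT hf, sub_sub_cancel] at h1
  have h2 := resolvent_add_reflResolvent hA hB f
  have h3 : opResolvent B (reflResolvent A f) = opResolvent A f - vMin A B := by
    rw [h1, sub_sub_cancel]
  refine ⟨h3, ?_⟩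
  rw [h3] at h2
  rw [eq_sub_of_add_eq' h2]
  abel

/-- The next displacement `Tf - T(Tf)` has norm at most `‖v‖` by nonexpansiveness, and `v` is the
only element of minimal norm. -/
theorem drOp_mem_fixVT (hA : IsMaxMonotoneOp A) (hB : IsMaxMonotoneOp B)
    (hran : closure (ranDispl A B) = closure (setD A B) ∩ closure (setR A B))
    {f : X} (hf : f ∈ fixVT A B) : drOp A B f ∈ fixVT A B := by
  have h1 := norm_drOp_sub_le hA hB f (drOp A B f)
  have h2 : f - drOp A B f = vMin A B := by rw [drOp_of_mem_fixVT hf, sub_sub_cancel]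
  rw [h2] at h1
  have h3 := eq_of_norm_le_of_sq_le_inner h1
    ((vMin_eq_and_le hA hB hran).2 _ (subset_closure ⟨drOp A B f, rfl⟩))
  change vMin A B + _ = _
  rw [← h3, sub_add_cancel]

/-- Along the orbit of a point of `Fix (v + T)`, the two resolvents move by `-v_R` and `-v_D`. -/
theorem resolvent_drOp_of_mem_fixVT (hA : IsMaxMonotoneOp A) (hB : IsMaxMonotoneOp B)
    (hran : closure (ranDispl A B) = closure (setD A B) ∩ closure (setR A B))
    {f : X} (hf : f ∈ fixVT A B) :
    opResolvent A (drOp A B f) = opResolvent A f - vR A B ∧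
      opResolvent (opInv A) (drOp A B f) = opResolvent (opInv A) f - vD A B := by
  have hg := drOp_mem_fixVT hA hB hran hf
  have hv := (vMin_eq_and_le hA hB hran).1
  have horth := inner_vD_vR hA hB
  have hD := (vD_mem_and_le hA hB).2
  have hR := (vR_mem_and_le hA hB).2
  have hTf := drOp_of_mem_fixVT hf
  have hTg := drOp_of_mem_fixVT hg
  set g := drOp A B f with hgdef
  have hfg : f - g = vMin A B := by rw [hTf, sub_sub_cancel]
  have hBf := hB.resolvent_mem (reflResolvent A f)
  have hBg := hB.resolvent_mem (reflResolvent A g)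
  rw [(resolvent_reflResolvent_of_mem_fixVT hA hB hf).1, (resolvent_reflResolvent_of_mem_fixVT hA hB hf).2] at hBf
  rw [(resolvent_reflResolvent_of_mem_fixVT hA hB hg).1, (resolvent_reflResolvent_of_mem_fixVT hA hB hg).2] at hBg
  have hAf := hA.resolvent_mem f
  have hAg := hA.resolvent_mem g
  have e0 : opResolvent A g - opResolvent A f + (opResolvent (opInv A) g - opResolvent (opInv A) f)
      = -vMin A B := by
    rw [sub_add_sub_comm, hA.resolvent_add, hA.resolvent_add, ← hfg, neg_sub]
  have n1 := norm_sq_drOp_sub_le hA hB g f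
  have n2 := norm_sq_resolvent_sub_le hA g f
  rw [hTg, ← hgdef, hTf, sub_sub_sub_cancel_right, ← hTf] at n1
  have n3 : ‖g - f‖ ^ 2 = ‖vD A B‖ ^ 2 + ‖vR A B‖ ^ 2 := by
    rw [norm_sub_rev, hfg, hv, norm_add_sq_real, horth]
    ring
  -- Mixing the `A`-data of one point with the `B`-data of the other gives inequalities in both
  -- directions, hence `⟪p' - p, v_D⟫ = 0` and `⟪q' - q, v_R⟫ = 0`.
  have d1 := hD _ (subset_closure ⟨_, ⟨_, hAg⟩, _, ⟨_, hBf⟩, rfl⟩)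
  have d2 := hD _ (subset_closure ⟨_, ⟨_, hAf⟩, _, ⟨_, hBg⟩, rfl⟩)
  have r1 := hR _ (subset_closure
    ⟨_, Set.mem_iUnion.2 ⟨_, hAg⟩, _, Set.mem_iUnion.2 ⟨_, hBf⟩, rfl⟩)
  have r2 := hR _ (subset_closure
    ⟨_, Set.mem_iUnion.2 ⟨_, hAf⟩, _, Set.mem_iUnion.2 ⟨_, hBg⟩, rfl⟩)
  set p := opResolvent A f
  set q := opResolvent (opInv A) f
  set p' := opResolvent A g
  set q' := opResolvent (opInv A) g
  rw [hv] at d1 d2 r1 r2 e0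
  have horth' := horth
  rw [real_inner_comm] at horth'
  simp only [inner_sub_left, inner_add_left, real_inner_self_eq_norm_sq, horth, horth']
    at d1 d2 r1 r2
  have e1 := congrArg (fun z => inner ℝ z (vD A B)) e0
  have e2 := congrArg (fun z => inner ℝ z (vR A B)) e0
  simp only [inner_sub_left, inner_add_left, inner_neg_left, real_inner_self_eq_norm_sq,
    horth, horth'] at e1 e2
  -- Pairing `e0` with `v_R` and `v_D` determines the cross terms, and `n2` bounds `‖p' - p‖² + ‖q'
  -- - q‖²` by `‖v_D‖² + ‖v_R‖²`.
  have s1 : ‖(p' - p) + vR A B‖ ^ 2 + ‖(q' - q) + vD A B‖ ^ 2 ≤ 0 := by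
    rw [norm_add_sq_real, norm_add_sq_real, inner_sub_left, inner_sub_left]
    linarith
  have s2 : 0 ≤ ‖(p' - p) + vR A B‖ ^ 2 := by positivity
  have s3 : 0 ≤ ‖(q' - q) + vD A B‖ ^ 2 := by positivity
  have s4 : p' - p + vR A B = 0 := norm_eq_zero.1 (sq_eq_zero_iff.1 (by linarith))
  have s5 : q' - q + vD A B = 0 := norm_eq_zero.1 (sq_eq_zero_iff.1 (by linarith))
  constructor
  · rw [eq_sub_iff_add_eq, ← sub_eq_zero, ← s4]
    abel
  · rw [eq_sub_iff_add_eq, ← sub_eq_zero, ← s5]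
    abel

theorem iterate_drOp_of_mem_fixVT (hA : IsMaxMonotoneOp A) (hB : IsMaxMonotoneOp B)
    (hran : closure (ranDispl A B) = closure (setD A B) ∩ closure (setR A B))
    {f : X} (hf : f ∈ fixVT A B) (n : ℕ) :
    (drOp A B)^[n] f ∈ fixVT A B ∧
      opResolvent A ((drOp A B)^[n] f) = opResolvent A f - (n : ℝ) • vR A B ∧
      opResolvent (opInv A) ((drOp A B)^[n] f)
        = opResolvent (opInv A) f - (n : ℝ) • vD A B := by
  induction n with
  | zero => simpa using hf
  | succ n ih =>
    obtain ⟨h1, h2, h3⟩ := ih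
    obtain ⟨h4, h5⟩ := resolvent_drOp_of_mem_fixVT hA hB hran h1
    rw [Function.iterate_succ_apply']
    refine ⟨drOp_mem_fixVT hA hB hran h1, ?_, ?_⟩
    · rw [h4, h2]
      push_cast
      module
    · rw [h5, h3]
      push_cast
      module

/-- The shifts `n v_R` and `n v_D` cancel the drift of the orbit of `f`. -/
theorem norm_sq_shiftedShadow_sub (hA : IsMaxMonotoneOp A) (hB : IsMaxMonotoneOp B)
    (hran : closure (ranDispl A B) = closure (setD A B) ∩ closure (setR A B))
    {f : X} (hf : f ∈ fixVT A B) (x : X) (n : ℕ) :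
    ‖shiftedShadow A B x n - WithLp.toLp 2 (opResolvent A f, opResolvent (opInv A) f)‖ ^ 2
      = ‖opResolvent A ((drOp A B)^[n] x) - opResolvent A ((drOp A B)^[n] f)‖ ^ 2
        + ‖opResolvent (opInv A) ((drOp A B)^[n] x)
          - opResolvent (opInv A) ((drOp A B)^[n] f)‖ ^ 2 := by
  obtain ⟨-, h2, h3⟩ := iterate_drOp_of_mem_fixVT hA hB hran hf n
  rw [WithLp.prod_norm_sq_eq_of_L2, h2, h3]
  congr 3
  · change opResolvent A ((drOp A B)^[n] x) + (n : ℝ) • vR A B - opResolvent A f = _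
    abel
  · change opResolvent (opInv A) ((drOp A B)^[n] x) + (n : ℝ) • vD A B
      - opResolvent (opInv A) f = _
    abel

theorem isFejerMonotone_shiftedShadow (hA : IsMaxMonotoneOp A) (hB : IsMaxMonotoneOp B)
    (hran : closure (ranDispl A B) = closure (setD A B) ∩ closure (setR A B))
    (hFix : (fixVT A B).Nonempty) (x : X) :
    IsFejerMonotone
      ((fun f => (WithLp.toLp 2 (opResolvent A f, opResolvent (opInv A) f) :
        WithLp 2 (X × X))) '' fixVT A B)
      (shiftedShadow A B x) := by
  refine ⟨hFix.image _, ?_⟩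
  rintro _ ⟨f, hf, rfl⟩ n
  refine le_of_sq_le_sq ?_ (norm_nonneg _)
  rw [norm_sq_shiftedShadow_sub hA hB hran hf, norm_sq_shiftedShadow_sub hA hB hran hf,
    Function.iterate_succ_apply', Function.iterate_succ_apply']
  exact (norm_sq_resolvent_sub_le hA _ _).trans (norm_sq_drOp_sub_le hA hB _ _)

theorem IsFejerMonotone.isBounded_range {H : Type*} [NormedAddCommGroup H] {C : Set H}
    {s : ℕ → H} (h : IsFejerMonotone C s) : Bornology.IsBounded (Set.range s) := by
  obtain ⟨c, hc⟩ := h.1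
  refine (Metric.isBounded_iff_subset_closedBall c).2 ⟨‖s 0 - c‖, ?_⟩
  rintro _ ⟨n, rfl⟩
  rw [mem_closedBall_iff_norm]
  exact antitone_nat_of_succ_le (f := fun n => ‖s n - c‖) (h.2 c hc) n.zero_le

/-- The extended solution set of the normal problem in terms of `Fix (v + T)`. -/
theorem exists_mem_fixVT_of_mem_normalS (hA : IsMaxMonotoneOp A) (hB : IsMaxMonotoneOp B)
    {z k : X} (h : (z, k) ∈ normalS A B) :
    ∃ f ∈ fixVT A B, opResolvent A f = z ∧ opResolvent (opInv A) f = k + vMin A B := by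
  obtain ⟨hk, u, hu, rfl⟩ := h
  simp only [neg_add_eq_sub] at hk
  change u ∈ A z at hu
  change -(u - vMin A B) ∈ B (z - vMin A B) at hk
  have h1 := hA.1.opResolvent_eq hu
  have h2 := hA.1.opResolvent_opInv_eq hu
  -- Since `u = k + v`, the fixed point attached to `(z, k)` is `z + k + v`.
  refine ⟨z + u, ?_, h1, h2.trans (neg_add_cancel_comm _ _).symm⟩
  have h3 := hB.1.opResolvent_eq hk
  have e : z - vMin A B + -(u - vMin A B) = z - u := by abel
  rw [e] at h3
  change vMin A B + drOp A B (z + u) = z + u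
  rw [drOp_eq hA, reflResolvent_eq hA, h1, h2, h3]
  abel

theorem mem_normalS_of_mem_fixVT (hA : IsMaxMonotoneOp A) (hB : IsMaxMonotoneOp B)
    {f : X} (hf : f ∈ fixVT A B) :
    (opResolvent A f, opResolvent (opInv A) f - vMin A B) ∈ normalS A B := by
  obtain ⟨h1, h2⟩ := resolvent_reflResolvent_of_mem_fixVT hA hB hf
  have hBf := hB.resolvent_mem (reflResolvent A f)
  rw [h1, h2, ← neg_sub (opResolvent (opInv A) f)] at hBf
  exact ⟨hBf, _, hA.resolvent_mem f, neg_add_eq_sub _ _⟩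

theorem isFejerMonotone_normalS (hA : IsMaxMonotoneOp A) (hB : IsMaxMonotoneOp B)
    (hran : closure (ranDispl A B) = closure (setD A B) ∩ closure (setR A B))
    (hFix : (fixVT A B).Nonempty) (x : X) :
    IsFejerMonotone
      ((WithLp.toLp 2 : X × X → WithLp 2 (X × X)) '' normalS A B)
      (fun n => WithLp.toLp 2 (0, -vMin A B) + shiftedShadow A B x n) := by
  obtain ⟨f, hf⟩ := hFix
  refine ⟨⟨_, _, mem_normalS_of_mem_fixVT hA hB hf, rfl⟩, ?_⟩
  rintro _ ⟨⟨z, k⟩, hzk, rfl⟩ n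
  obtain ⟨f, hf, h1, h2⟩ := exists_mem_fixVT_of_mem_normalS hA hB hzk
  have e : ∀ y : WithLp 2 (X × X), WithLp.toLp 2 (0, -vMin A B) + y - WithLp.toLp 2 (z, k)
      = y - WithLp.toLp 2 (opResolvent A f, opResolvent (opInv A) f) := by
    intro y
    have : (WithLp.toLp 2 (opResolvent A f, opResolvent (opInv A) f) : WithLp 2 (X × X))
        = WithLp.toLp 2 (z, k) - WithLp.toLp 2 (0, -vMin A B) := by
      rw [h1, h2, ← WithLp.toLp_sub, Prod.mk_sub_mk, sub_zero, sub_neg_eq_add]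
    rw [this]
    abel
  simp only [e]
  exact (isFejerMonotone_shiftedShadow hA hB hran ⟨f, hf⟩ x).2 _ ⟨f, hf, rfl⟩ n

/-- The reflected resolvent is nonexpansive: passing from `J_A + J_{A⁻¹}` to `J_A - J_{A⁻¹}` only
flips the sign of a nonnegative cross term. -/
theorem norm_sq_resolvent_reflResolvent_sub_le (hA : IsMaxMonotoneOp A)
    (hB : IsMaxMonotoneOp B) (x y : X) :
    ‖opResolvent B (reflResolvent A x) - opResolvent B (reflResolvent A y)‖ ^ 2
      + ‖opResolvent (opInv B) (reflResolvent A x)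
        - opResolvent (opInv B) (reflResolvent A y)‖ ^ 2 ≤ ‖x - y‖ ^ 2 := by
  refine (norm_sq_resolvent_sub_le hB _ _).trans ?_
  have h := inner_resolvent_sub_nonneg hA x y
  have e : x - y = (opResolvent A x - opResolvent A y)
      + (opResolvent (opInv A) x - opResolvent (opInv A) y) := by
    rw [sub_add_sub_comm, hA.resolvent_add, hA.resolvent_add]
  rw [reflResolvent_eq hA, reflResolvent_eq hA, sub_sub_sub_comm, congrArg norm e,
    norm_add_sq_real, norm_sub_sq_real]
  linarith

theorem norm_iterate_drOp_sub_le (hA : IsMaxMonotoneOp A) (hB : IsMaxMonotoneOp B)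
    (x y : X) (n : ℕ) : ‖(drOp A B)^[n] x - (drOp A B)^[n] y‖ ≤ ‖x - y‖ := by
  induction n with
  | zero => exact le_rfl
  | succ n ih =>
    rw [Function.iterate_succ_apply', Function.iterate_succ_apply']
    exact (norm_drOp_sub_le hA hB _ _).trans ih

theorem isBounded_shadow_reflResolvent (hA : IsMaxMonotoneOp A) (hB : IsMaxMonotoneOp B)
    (hran : closure (ranDispl A B) = closure (setD A B) ∩ closure (setR A B))
    (hFix : (fixVT A B).Nonempty) (x : X) :
    Bornology.IsBounded (Set.range fun n : ℕ =>
      (WithLp.toLp 2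
        (opResolvent B (reflResolvent A ((drOp A B)^[n] x)) + (n : ℝ) • vR A B,
          opResolvent (opInv B) (reflResolvent A ((drOp A B)^[n] x)) - (n : ℝ) • vD A B) :
        WithLp 2 (X × X))) := by
  obtain ⟨f, hf⟩ := hFix
  -- Along the orbit of `f` the pair `(J_B R_A, J_{B⁻¹} R_A)` drifts by `n (-v_R, v_D)`, so the
  -- shifted sequence stays within `‖x - f‖` of its value at `f`.
  refine (Metric.isBounded_iff_subset_closedBall (WithLp.toLp 2
    (opResolvent B (reflResolvent A f), opResolvent (opInv B) (reflResolvent A f)))).2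
    ⟨‖x - f‖, ?_⟩
  rintro _ ⟨n, rfl⟩
  rw [mem_closedBall_iff_norm]
  refine le_of_sq_le_sq ?_ (norm_nonneg _)
  obtain ⟨h1, h2, h3⟩ := iterate_drOp_of_mem_fixVT hA hB hran hf n
  obtain ⟨e1, e2⟩ := resolvent_reflResolvent_of_mem_fixVT hA hB hf
  obtain ⟨e3, e4⟩ := resolvent_reflResolvent_of_mem_fixVT hA hB h1
  have hle := (norm_sq_resolvent_reflResolvent_sub_le hA hB ((drOp A B)^[n] x)
    ((drOp A B)^[n] f)).trans
    (pow_le_pow_left₀ (norm_nonneg _) (norm_iterate_drOp_sub_le hA hB x f n) 2)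
  refine le_trans (le_of_eq ?_) hle
  rw [e1, e2, e3, e4, h2, h3, WithLp.prod_norm_sq_eq_of_L2]
  congr 3
  · change opResolvent B (reflResolvent A ((drOp A B)^[n] x)) + (n : ℝ) • vR A B
      - (opResolvent A f - vMin A B) = _
    abel
  · change opResolvent (opInv B) (reflResolvent A ((drOp A B)^[n] x)) - (n : ℝ) • vD A B
      - (vMin A B - opResolvent (opInv A) f) = _
    abel

end Iterates

end DouglasRachford

theorem mainTheorem5 {X : Type*} [NormedAddCommGroup X] [InnerProductSpace ℝ X]
    [CompleteSpace X] (A B : X → Set X)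
    (hA : IsMaxMonotoneOp A) (hB : IsMaxMonotoneOp B)
    (hran : closure (ranDispl A B) = closure (setD A B ∩ setR A B))
    (hDR : closure (setD A B ∩ setR A B) = closure (setD A B) ∩ closure (setR A B))
    (hFix : (fixVT A B).Nonempty) (x : X) :
    IsFejerMonotone
      ((fun f => (WithLp.toLp 2 (opResolvent A f, opResolvent (opInv A) f) :
        WithLp 2 (X × X))) '' fixVT A B)
      (shiftedShadow A B x) ∧
    Bornology.IsBounded (Set.range (shiftedShadow A B x)) ∧
    Bornology.IsBounded (Set.range fun n : ℕ =>
      (WithLp.toLp 2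
        (opResolvent B (reflResolvent A ((drOp A B)^[n] x)) + (n : ℝ) • vR A B,
          opResolvent (opInv B) (reflResolvent A ((drOp A B)^[n] x)) - (n : ℝ) • vD A B) :
        WithLp 2 (X × X))) ∧
    IsFejerMonotone
      ((WithLp.toLp 2 : X × X → WithLp 2 (X × X)) '' normalS A B)
      (fun n => WithLp.toLp 2 (0, -vMin A B) + shiftedShadow A B x n) ∧
    (Bornology.IsBounded (Set.range fun n : ℕ => opResolvent A ((drOp A B)^[n] x)) ↔
      vR A B = 0) ∧
    (vR A B ≠ 0 →
      Tendsto (fun n : ℕ => ‖opResolvent A ((drOp A B)^[n] x)‖) atTop atTop) ∧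
    (Bornology.IsBounded (Set.range fun n : ℕ => opResolvent (opInv A) ((drOp A B)^[n] x)) ↔
      vD A B = 0) ∧
    (vD A B ≠ 0 →
      Tendsto (fun n : ℕ => ‖opResolvent (opInv A) ((drOp A B)^[n] x)‖) atTop atTop) ∧
    (IsParamonotoneOp A → IsParamonotoneOp B →
      IsFejerMonotone
        ((WithLp.toLp 2 : X × X → WithLp 2 (X × X)) '' (normalZ A B ×ˢ normalK A B))
        (fun n => WithLp.toLp 2 (0, -vMin A B) + shiftedShadow A B x n)) := by
  have hran' := hran.trans hDR
  have hF := isFejerMonotone_shiftedShadow hA hB hran' hFix x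
  have hS := isFejerMonotone_normalS hA hB hran' hFix x
  have hbdd := hF.isBounded_range
  obtain ⟨C, hC⟩ := isBounded_iff_forall_norm_le.1 hbdd
  have h1 : Bornology.IsBounded (Set.range fun n : ℕ =>
      opResolvent A ((drOp A B)^[n] x) + (n : ℝ) • vR A B) := by
    refine isBounded_iff_forall_norm_le.2 ⟨C, ?_⟩
    rintro _ ⟨n, rfl⟩
    exact (WithLp.norm_fst_le _ (shiftedShadow A B x n)).trans (hC _ ⟨n, rfl⟩)
  have h2 : Bornology.IsBounded (Set.range fun n : ℕ =>
      opResolvent (opInv A) ((drOp A B)^[n] x) + (n : ℝ) • vD A B) := by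
    refine isBounded_iff_forall_norm_le.2 ⟨C, ?_⟩
    rintro _ ⟨n, rfl⟩
    exact (WithLp.norm_snd_le _ (shiftedShadow A B x n)).trans (hC _ ⟨n, rfl⟩)
  refine ⟨hF, hbdd, isBounded_shadow_reflResolvent hA hB hran' hFix x, hS,
    isBounded_range_iff_of_isBounded_add_smul h1,
    tendsto_norm_atTop_of_isBounded_add_smul h1,
    isBounded_range_iff_of_isBounded_add_smul h2,
    tendsto_norm_atTop_of_isBounded_add_smul h2, fun hpA hpB => ?_⟩
  rw [normalZ_prod_normalK_eq A B hpA hpB]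
  exact hS
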